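/- Let $p$ be a prime, $q=p^e$, and let $\mathcal P$ be a projective plane of order $q$. Coordinatise $\mathcal P$ by $\mathbb F_q$ as follows. Choose four points $O,X,Y,I$, no three collinear. Label the points of $\overline{OY}$ other than $Y$ bijectively as $(0,a)$, $a\in\mathbb F_q$, with $O=(0,0)$ and $\overline{XI}\cap\overline{OY}=(0,1)$. Put $(\infty)=Y$, $[\infty]=\overline{XY}$, $(1,0)=\overline{YI}\cap\overline{OX}$, $J=\overline{(1,0)(0,1)}\cap[\infty]$, $(a,0)=\overline{(0,a)J}\cap\overline{OX}$, $(a)=\overline{(0,a)(1,0)}\cap[\infty]$ (so $(0)=X$), $(a,b)=\overline{(a,0)Y}\cap\overline{(0,b)X}$, $[a]=\overline{(a,0)Y}$ and $[m,k]=\overline{(m)(0,k)}$. The PTR polynomial of the coordinatisation is the polynomial $T\in\mathbb F_q[X,Y,Z]$ of degree less than $q$ in each variable with $T(m,x,y)=k$ if and only if $(x,y)\in[m,k]$; the first variable of $T$ is thus the slope. For a point $A$ and a line $\ell$ let $\Gamma(A,\ell)$ be the group of collineations fixing every point on $\ell$ and every line through $A$. The plane is $(A,\ell)$-transitive if for any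 two distinct points $B,C\ne A$ not on $\ell$ that are collinear with $A$ some $\gamma\in\Gamma(A,\ell)$ maps $B$ to $C$. A line $\ell$ is a translation line if $\mathcal P$ is $(A,\ell)$-transitive for all points $A\in\ell$; a point $A$ is a translation point if $\mathcal P$ is $(A,\ell)$-transitive for all lines $\ell\ni A$; $\mathcal P$ is a translation plane (dual translation plane) if it has a translation line (translation point). It is of Lenz–Barlotti (LB) type at least V if it has a translation line $\ell$ and a translation point on $\ell$. It is of LB type at least II.2 if it is $(A,\ell)$- and $(B,m)$-transitive for some points $A,B$ and lines $\ell,m$ with $A,B\in\ell$, $A\in m$, $B\notin m$ (strictly II.2 if these are its only point-line transitivities). The coordinatisation is called optimal if: $\mathcal P$ is $((\infty),[\infty])$-transitive whenever it is $(A,\ell)$-transitive for some $A\in\ell$; $\mathcal P$ is $((0),[0])$-transitive whenever it is $(A,\ell)$-transitive for some $A\notin\ell$; $[\infty]$ is a translation line whenever $\mathcal P$ is a translation plane; and $(\infty)$ is a translation point whenever $\mathcal P$ is a dual translation plane. **Theorem.** Suppose that $\mathcal P$ is $((\infty),[\infty])$-transitive, that $\Gamma((\infty),[\infty])$ is elementary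 abelian, and that the coordinatisation is optimal with additive loop equal to field addition: $T(1,x,y)=x+y$ for all $x,y\in\mathbb F_q$. Then $$T(X,Y,Z)=M_2(X,Y)+Z,\qquad M_2(X,Y)=\sum_{i=1}^{q-1}\sum_{j=1}^{q-1}c_{ij}X^iY^j ,$$ and the following hold. 1. If $q>2$, then $M_2(X,Y)=\sum_{i=1}^{q-2}\sum_{j=1}^{q-2}c_{ij}X^iY^j$. 2. If $\mathcal P$ is of LB type at least II.2 (in particular, if it is strictly of type II.2), then $M_2(x,M_2(y,z))=M_2(M_2(x,y),z)$ for all $x,y,z\in\mathbb F_q$. 3. If $\mathcal P$ is a translation plane, then $M_2(X,Y)=\sum_{i=1}^{q-1}\sum_{j=0}^{e-1}c_{ij}X^{i}Y^{p^j}$. 4. If $\mathcal P$ is a dual translation plane, then $M_2(X,Y)=\sum_{i=0}^{e-1}\sum_{j=1}^{q-1}c_{ij}X^{p^i}Y^{j}$. 5. If $\mathcal P$ is of LB type at least V, then $M_2(X,Y)=\sum_{i=0}^{e-1}\sum_{j=0}^{e-1}c_{ij}X^{p^i}Y^{p^j}$. (The coefficients $c_{ij}\in\mathbb F_q$ may be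 named differently in each display.) -/

import Mathlib

open Configuration

namespace PlaneCoord

section Geometry

variable (P L : Type*) [Membership P L]

/-- The full collineation group of an incidence structure: pairs of permutations of the points and
of the lines that preserve incidence in both directions. -/
def collineationGroup : Subgroup (Equiv.Perm P × Equiv.Perm L) where
  carrier := {g | ∀ (A : P) (l : L), g.1 A ∈ g.2 l ↔ A ∈ l}
  one_mem' := fun _ _ => Iff.rfl
  mul_mem' := by
    intro g h hg hh A l
    exact (hg (h.1 A) (h.2 l)).trans (hh A l)
  inv_mem' := by
    intro g hg A l
    have h := hg (g.1⁻¹ A) (g.2⁻¹ l)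
    simpa using h.symm

variable {P L}

/-- The group `Γ(A, l)` of all central collineations with center `A` and axis `l`: the collineations
that fix every point on `l` and every line through `A`. -/
def centralCollineations (A : P) (l : L) : Subgroup (Equiv.Perm P × Equiv.Perm L) where
  carrier := {g | g ∈ collineationGroup P L ∧ (∀ B : P, B ∈ l → g.1 B = B) ∧
    ∀ m : L, A ∈ m → g.2 m = m}
  one_mem' := ⟨one_mem _, fun _ _ => rfl, fun _ _ => rfl⟩
  mul_mem' := by
    rintro g h ⟨hg, hg1, hg2⟩ ⟨hh, hh1, hh2⟩
    refine ⟨mul_mem hg hh, fun B hB => ?_, fun m hm => ?_⟩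
    · change g.1 (h.1 B) = B
      rw [hh1 B hB, hg1 B hB]
    · change g.2 (h.2 m) = m
      rw [hh2 m hm, hg2 m hm]
  inv_mem' := by
    rintro g ⟨hg, hg1, hg2⟩
    refine ⟨inv_mem hg, fun B hB => ?_, fun m hm => ?_⟩
    · change g.1⁻¹ B = B
      rw [Equiv.Perm.inv_eq_iff_eq]
      exact (hg1 B hB).symm
    · change g.2⁻¹ m = m
      rw [Equiv.Perm.inv_eq_iff_eq]
      exact (hg2 m hm).symm

/-- `(A, l)`-transitivity: any two distinct points `B`, `C` that are collinear with `A`, different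
from `A` and not on `l`, are exchanged by some `g ∈ Γ(A, l)`, in the sense that `g` maps `B` to
`C`. -/
def IsTransitive (A : P) (l : L) : Prop :=
  ∀ B C : P, B ≠ C → (∃ m : L, A ∈ m ∧ B ∈ m ∧ C ∈ m) → B ≠ A → C ≠ A → B ∉ l → C ∉ l →
    ∃ g ∈ centralCollineations A l, g.1 B = C

variable (P) in
/-- `l` is a translation line: the plane is `(A, l)`-transitive for all points `A` on `l`. -/
def IsTranslationLine (l : L) : Prop := ∀ A : P, A ∈ l → IsTransitive A l

variable (L) in
/-- `A` is a translation point: the plane is `(A, l)`-transitive for all lines `l` through `A`. -/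
def IsTranslationPoint (A : P) : Prop := ∀ l : L, A ∈ l → IsTransitive A l

variable (P L)

/-- The set of all point-line transitivities of the plane. -/
def transitivities : Set (P × L) := {s | IsTransitive s.1 s.2}

def IsTranslationPlane : Prop := ∃ l : L, IsTranslationLine P l

def IsDualTranslationPlane : Prop := ∃ A : P, IsTranslationPoint L A

variable {P L} in
/-- The configuration that defines Lenz-Barlotti type II.2: an incident pair `(A, l)` and a
non-incident pair `(B, m)` such that `B` lies on `l` and `m` passes through `A`. -/
def IsConfigII2 (S : Set (P × L)) : Prop :=
  ∃ (A B : P) (l m : L), A ∈ l ∧ B ∈ l ∧ A ∈ m ∧ B ∉ m ∧ S = {(A, l), (B, m)}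

/-- The plane is strictly of Lenz-Barlotti type II.2. -/
def IsLenzBarlottiII2 : Prop := IsConfigII2 (transitivities P L)

/-- The plane is of Lenz-Barlotti type at least II.2: its point-line transitivities contain a
configuration of type II.2. -/
def IsAtLeastLenzBarlottiII2 : Prop := ∃ S ⊆ transitivities P L, IsConfigII2 S

theorem IsLenzBarlottiII2.atLeast (h : IsLenzBarlottiII2 P L) : IsAtLeastLenzBarlottiII2 P L :=
  ⟨_, subset_rfl, h⟩

/-- The plane is of Lenz-Barlotti type at least V: its point-line transitivities contain all
`(A, l)` with `A` on `l` and all `(V, m)` with `m` through `V`, for some line `l` and some point `V`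
on `l`. -/
def IsAtLeastLenzBarlottiV : Prop :=
  ∃ (V : P) (l : L), V ∈ l ∧ IsTranslationLine P l ∧ IsTranslationPoint L V

end Geometry

/-- A finite group is elementary abelian (for the prime `p`) if it is abelian and all its elements
have order dividing `p`. -/
def IsElementaryAbelian (p : ℕ) (G : Type*) [Group G] : Prop :=
  (∀ a b : G, a * b = b * a) ∧ ∀ a : G, a ^ p = 1

section Join

variable {P : Type*} (L : Type*) [Membership P L] [ProjectivePlane P L]

open Classical in
/-- The line through two points (an arbitrary line if the points coincide; this case never occurs
below). -/
noncomputable def join (A B : P) : L :=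
  if h : A ≠ B then HasLines.mkLine h else (Nondegenerate.exists_line A).choose

variable {L}

variable (P) in
open Classical in
/-- The intersection point of two lines (an arbitrary point if the lines coincide; this case never
occurs below). -/
noncomputable def meet (l m : L) : P :=
  if h : l ≠ m then HasPoints.mkPoint h else (Nondegenerate.exists_point l).choose

theorem join_mem {A B : P} (h : A ≠ B) : A ∈ join L A B ∧ B ∈ join L A B := by
  unfold join
  rw [dif_pos h]
  exact HasLines.mkLine_ax h

theorem meet_mem {l m : L} (h : l ≠ m) : meet P l m ∈ l ∧ meet P l m ∈ m := by
  unfold meet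
  rw [dif_pos h]
  exact HasPoints.mkPoint_ax h

end Join

/-- The free choices in the coordinatisation of a plane by a set `R` with two designated elements
`0` and `1`: a quadrangle `O, X, Y, I` (no three of the points collinear), and a labelling of the
points of `OY` different from `Y` by the elements of `R`, the label `a` standing for the point
`(0, a)`, such that `O` has the label `0` and the intersection point of `XI` and `OY` has the
label `1`. -/
structure Coordinatisation (P L R : Type*) [Membership P L] [ProjectivePlane P L]
    [Zero R] [One R] where
  O : P
  X : P
  Y : P
  I : P
  not_collinear_OXY : ∀ l : L, ¬ (O ∈ l ∧ X ∈ l ∧ Y ∈ l)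
  not_collinear_OXI : ∀ l : L, ¬ (O ∈ l ∧ X ∈ l ∧ I ∈ l)
  not_collinear_OYI : ∀ l : L, ¬ (O ∈ l ∧ Y ∈ l ∧ I ∈ l)
  not_collinear_XYI : ∀ l : L, ¬ (X ∈ l ∧ Y ∈ l ∧ I ∈ l)
  label : R → P
  label_injective : Function.Injective label
  range_label : Set.range label = {A | A ∈ join L O Y ∧ A ≠ Y}
  label_zero : label 0 = O
  label_one : label 1 = meet P (join L X I) (join L O Y)

namespace Coordinatisation

variable {P L R : Type*} [Membership P L] [ProjectivePlane P L] [Zero R] [One R]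
  (c : Coordinatisation P L R)

/-- The line `[∞] = XY`. -/
noncomputable def lineInf : L := join L c.X c.Y

/-- The point `(1, 0)`, the intersection of `YI` and `[0, 0] = OX`. -/
noncomputable def oneZero : P := meet P (join L c.Y c.I) (join L c.O c.X)

/-- The point `J = (1)`, the intersection of the line through `(1, 0)` and `(0, 1)` with `[∞]`. -/
noncomputable def J : P := meet P (join L c.oneZero (c.label 1)) c.lineInf

/-- The point `(a, 0)`, the intersection of the line through `(0, a)` and `J` with `[0, 0] = OX`. -/
noncomputable def ptX (a : R) : P := meet P (join L (c.label a) c.J) (join L c.O c.X)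

/-- The point `(a)`, the intersection of the line through `(0, a)` and `(1, 0)` with `[∞]`. -/
noncomputable def slope (a : R) : P := meet P (join L (c.label a) c.oneZero) c.lineInf

/-- The affine point `(a, b)`, the intersection of the line through `(a, 0)` and `Y` with the line
through `(0, b)` and `X`. -/
noncomputable def pt (a b : R) : P := meet P (join L (c.ptX a) c.Y) (join L (c.label b) c.X)

/-- The line `[a]` through `(a, 0)` and `Y = (∞)`. -/
noncomputable def vline (a : R) : L := join L (c.ptX a) c.Y

/-- The line `[m, k]` through `(m)` and `(0, k)`. -/
noncomputable def line (m k : R) : L := join L (c.slope m) (c.label k)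

/-- The coordinatisation is optimal: if the plane has an incident point-line transitivity, then
`((∞), [∞])` is one; if it has a non-incident one, then `((0), [0])` is one; if it is a translation
plane, then `[∞]` is a translation line; if it is a dual translation plane, then `(∞)` is a
translation point. -/
def IsOptimal : Prop :=
  ((∃ (A : P) (l : L), A ∈ l ∧ IsTransitive A l) → IsTransitive c.Y c.lineInf) ∧
  ((∃ (A : P) (l : L), A ∉ l ∧ IsTransitive A l) → IsTransitive (c.slope 0) (c.vline 0)) ∧
  (IsTranslationPlane P L → IsTranslationLine P c.lineInf) ∧
  (IsDualTranslationPlane P L → IsTranslationPoint L c.Y)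

end Coordinatisation

/-- `T` is the PTR polynomial of the coordinatisation `c` of a plane by a finite field: the reduced
polynomial such that `T(m, x, y) = k` if and only if the point `(x, y)` lies on the line
`[m, k]`. -/
def IsPTRPolynomial {P L F : Type*} [Membership P L] [ProjectivePlane P L] [Field F] [Fintype F]
    (c : Coordinatisation P L F) (T : MvPolynomial (Fin 3) F) : Prop :=
  (∀ i, T.degreeOf i < Fintype.card F) ∧
  ∀ m x y k : F, MvPolynomial.eval ![m, x, y] T = k ↔ c.pt x y ∈ c.line m k

end PlaneCoord

/-! Write `t` for the ternary operation and `M(m,x) = t m x 0` for its multiplication. Each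
transitivity supplies central collineations. Those used here fix `(∞)` and `[∞]`, so they act on
coordinates, and since they preserve incidence they give identities for `t`. The four cases are: -
center `(∞)`, axis `[∞]`: shifts of the last argument commute with `t`; as `t 1 x y = x + y`, they
are field translations, whence `t m x y = M(m,x) + y` (`eq_add`); - center `(0)`, axis `[0]`: `M` is
associative (`mul_assoc_of_transitive`); - center `(0)`, axis `[∞]`: `M` is additive in its second
argument (`add_right_of_transitive`); - center `(∞)`, axis `[0]`: `M` is additive in its first
argument (`add_left_of_transitive`). Optimality moves the transitivities of the plane to these
positions.

The rest concerns polynomials of degree less than `q` in each variable, which are determined by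
their values. Vanishing of `M` on the axes removes the exponent 0. For a nonzero argument the other
argument is permuted by `M`; a permutation of a field with more than two elements has value sum 0,
and that sum is minus the coefficient at `q - 1`. An additive function has only exponents that are
powers of `p`, since comparing `f(X + r)` with `f(X) + f(r)` kills every coefficient `b j` for which
some interior binomial `j.choose k` is nonzero modulo `p`. -/

namespace PlaneCoord

/-! ### Joins and intersections in a projective plane. -/

section Incidence

variable {P L : Type*} [Membership P L] [ProjectivePlane P L]

theorem line_unique {A B : P} {l m : L} (h : A ≠ B) (hA : A ∈ l) (hB : B ∈ l) (hA' : A ∈ m)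
    (hB' : B ∈ m) : l = m :=
  (Nondegenerate.eq_or_eq hA hB hA' hB').resolve_left h

theorem point_unique {A B : P} {l m : L} (h : l ≠ m) (hA : A ∈ l) (hB : B ∈ l) (hA' : A ∈ m)
    (hB' : B ∈ m) : A = B :=
  (Nondegenerate.eq_or_eq hA hB hA' hB').resolve_right h

theorem eq_join {A B : P} {l : L} (h : A ≠ B) (hA : A ∈ l) (hB : B ∈ l) : l = join L A B :=
  line_unique h hA hB (join_mem h).1 (join_mem h).2

variable (L) in
theorem exists_line_through (A B : P) : ∃ l : L, A ∈ l ∧ B ∈ l := by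
  by_cases h : A = B
  · subst h
    obtain ⟨C, D, -, -, l, -, hC, -, -, hD, -⟩ := ProjectivePlane.exists_config (P := P) (L := L)
    -- `C` and `D` are distinct because only `D` lies on `l`; so `A` can be joined to at least one
    -- of them.
    by_cases hA : A = C
    · have hAD : A ≠ D := fun h => hC (hA ▸ h ▸ hD)
      exact ⟨_, (join_mem hAD).1, (join_mem hAD).1⟩
    · exact ⟨_, (join_mem hA).1, (join_mem hA).1⟩
  · exact ⟨_, join_mem h⟩

theorem ne_of_not_collinear {A B C : P} (h : ∀ l : L, ¬ (A ∈ l ∧ B ∈ l ∧ C ∈ l)) :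
    A ≠ B ∧ A ≠ C ∧ B ≠ C := by
  obtain ⟨l, h1, h2⟩ := exists_line_through L A C
  obtain ⟨m, h3, h4⟩ := exists_line_through L A B
  refine ⟨?_, ?_, ?_⟩
  · rintro rfl; exact h l ⟨h1, h1, h2⟩
  · rintro rfl; exact h m ⟨h3, h4, h3⟩
  · rintro rfl; exact h l ⟨h1, h2, h2⟩

end Incidence

/-! ### Coordinates of points and lines. -/

namespace Coordinatisation

section Basic

variable {P L R : Type*} [Membership P L] [ProjectivePlane P L] [Zero R] [One R]
  (c : Coordinatisation P L R)

theorem O_ne_X : c.O ≠ c.X := (ne_of_not_collinear c.not_collinear_OXY).1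
theorem O_ne_Y : c.O ≠ c.Y := (ne_of_not_collinear c.not_collinear_OXY).2.1
theorem X_ne_Y : c.X ≠ c.Y := (ne_of_not_collinear c.not_collinear_OXY).2.2
theorem X_ne_I : c.X ≠ c.I := (ne_of_not_collinear c.not_collinear_OXI).2.2
theorem Y_ne_I : c.Y ≠ c.I := (ne_of_not_collinear c.not_collinear_OYI).2.2

theorem X_mem_lineInf : c.X ∈ c.lineInf := (join_mem c.X_ne_Y).1
theorem Y_mem_lineInf : c.Y ∈ c.lineInf := (join_mem c.X_ne_Y).2

theorem O_notMem_lineInf : c.O ∉ c.lineInf := fun h =>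
  c.not_collinear_OXY _ ⟨h, c.X_mem_lineInf, c.Y_mem_lineInf⟩

theorem Y_notMem_OX : c.Y ∉ join L c.O c.X := fun h =>
  c.not_collinear_OXY _ ⟨(join_mem c.O_ne_X).1, (join_mem c.O_ne_X).2, h⟩

theorem X_notMem_OY : c.X ∉ join L c.O c.Y := fun h =>
  c.not_collinear_OXY _ ⟨(join_mem c.O_ne_Y).1, h, (join_mem c.O_ne_Y).2⟩

theorem label_mem (a : R) : c.label a ∈ join L c.O c.Y :=
  (c.range_label ▸ Set.mem_range_self a : c.label a ∈ {A | A ∈ join L c.O c.Y ∧ A ≠ c.Y}).1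

theorem label_ne_Y (a : R) : c.label a ≠ c.Y :=
  (c.range_label ▸ Set.mem_range_self a : c.label a ∈ {A | A ∈ join L c.O c.Y ∧ A ≠ c.Y}).2

theorem exists_label {A : P} (h : A ∈ join L c.O c.Y) (hA : A ≠ c.Y) : ∃ a, c.label a = A := by
  have : A ∈ Set.range c.label := c.range_label ▸ ⟨h, hA⟩
  exact this

theorem label_notMem_lineInf (a : R) : c.label a ∉ c.lineInf := fun h =>
  c.X_notMem_OY (line_unique (c.label_ne_Y a) h c.Y_mem_lineInf (c.label_mem a)
    (join_mem c.O_ne_Y).2 ▸ c.X_mem_lineInf)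

theorem eq_X {A : P} (h : A ∈ c.lineInf) (h' : A ∈ join L c.O c.X) : A = c.X :=
  point_unique (fun (e : c.lineInf = _) => c.O_notMem_lineInf (e ▸ (join_mem c.O_ne_X).1)) h
    c.X_mem_lineInf h' (join_mem c.O_ne_X).2

theorem eq_O {A : P} (h : A ∈ join L c.O c.Y) (h' : A ∈ join L c.O c.X) : A = c.O :=
  point_unique (fun (e : join L c.O c.Y = _) => c.X_notMem_OY (e ▸ (join_mem c.O_ne_X).2)) h
    (join_mem c.O_ne_Y).1 h' (join_mem c.O_ne_X).1

theorem oneZero_mem : c.oneZero ∈ join L c.Y c.I ∧ c.oneZero ∈ join L c.O c.X :=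
  meet_mem fun h => c.Y_notMem_OX (h ▸ (join_mem c.Y_ne_I).1)

theorem oneZero_notMem_lineInf : c.oneZero ∉ c.lineInf := fun h =>
  c.not_collinear_XYI _ ⟨c.eq_X h c.oneZero_mem.2 ▸ c.oneZero_mem.1, join_mem c.Y_ne_I⟩

theorem oneZero_notMem_OY : c.oneZero ∉ join L c.O c.Y := fun h =>
  c.not_collinear_OYI _ ⟨c.eq_O h c.oneZero_mem.2 ▸ c.oneZero_mem.1, join_mem c.Y_ne_I⟩

theorem label_ne_oneZero (a : R) : c.label a ≠ c.oneZero := fun h =>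
  c.oneZero_notMem_OY (h ▸ c.label_mem a)

theorem slope_mem (m : R) :
    c.slope m ∈ join L (c.label m) c.oneZero ∧ c.slope m ∈ c.lineInf :=
  meet_mem fun h => c.label_notMem_lineInf m (h ▸ (join_mem (c.label_ne_oneZero m)).1)

theorem slope_ne_Y (m : R) : c.slope m ≠ c.Y := fun h =>
  c.oneZero_notMem_OY (line_unique (c.label_ne_Y m) (join_mem (c.label_ne_oneZero m)).1
    (h ▸ (c.slope_mem m).1) (c.label_mem m) (join_mem c.O_ne_Y).2 ▸
      (join_mem (c.label_ne_oneZero m)).2)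

theorem slope_ne_oneZero (m : R) : c.slope m ≠ c.oneZero := fun h =>
  c.oneZero_notMem_lineInf (h ▸ (c.slope_mem m).2)

/-- Projection from `(1, 0)` is a perspectivity from `OY` to `[∞]` fixing `Y`; this gives
injectivity here and surjectivity in `exists_slope`. -/
theorem slope_injective : Function.Injective c.slope := by
  intro m n h
  have hl := line_unique (c.slope_ne_oneZero m) (c.slope_mem m).1
    (join_mem (c.label_ne_oneZero m)).2 (h ▸ (c.slope_mem n).1)
    (join_mem (c.label_ne_oneZero n)).2
  refine c.label_injective (point_unique (l := join L (c.label m) c.oneZero) ?_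
    (join_mem (c.label_ne_oneZero m)).1 (hl ▸ (join_mem (c.label_ne_oneZero n)).1)
    (c.label_mem m) (c.label_mem n))
  exact fun e => c.oneZero_notMem_OY (e ▸ (join_mem (c.label_ne_oneZero m)).2)

theorem exists_slope {A : P} (h : A ∈ c.lineInf) (hA : A ≠ c.Y) : ∃ m, c.slope m = A := by
  have hA1 : A ≠ c.oneZero := fun e => c.oneZero_notMem_lineInf (e ▸ h)
  obtain ⟨hl1, hl2⟩ := join_mem (L := L) hA1
  have hne : join L A c.oneZero ≠ join L c.O c.Y := fun e => c.oneZero_notMem_OY (e ▸ hl2)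
  have hne' : join L A c.oneZero ≠ c.lineInf := fun e => c.oneZero_notMem_lineInf (e ▸ hl2)
  obtain ⟨h1, h2⟩ := meet_mem (P := P) hne
  obtain ⟨m, hm⟩ := c.exists_label h2 fun e =>
    hA (point_unique hne' hl1 (e ▸ h1) h c.Y_mem_lineInf)
  refine ⟨m, ?_⟩
  have e := eq_join (c.label_ne_oneZero m) (hm ▸ h1) hl2
  exact point_unique hne' (e ▸ (c.slope_mem m).1) hl1 (c.slope_mem m).2 h

theorem slope_zero : c.slope 0 = c.X := by
  have h : c.O ≠ c.oneZero := c.label_zero ▸ c.label_ne_oneZero 0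
  have e := eq_join h (join_mem c.O_ne_X).1 c.oneZero_mem.2
  refine c.eq_X (c.slope_mem 0).2 ?_
  rw [e, ← c.label_zero]
  exact (c.slope_mem 0).1

theorem label_one_ne_zero : c.label 1 ≠ c.label 0 := by
  intro h
  rw [c.label_zero] at h
  have hne : join L c.X c.I ≠ join L c.O c.Y := fun e =>
    c.X_notMem_OY (e ▸ (join_mem c.X_ne_I).1)
  have h1 := (meet_mem (P := P) hne).1
  rw [← c.label_one, h] at h1
  exact c.not_collinear_OXI _ ⟨h1, join_mem c.X_ne_I⟩

theorem one_ne_zero' (c : Coordinatisation P L R) : (1 : R) ≠ 0 := fun h =>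
  c.label_one_ne_zero (congrArg c.label h)

theorem J_eq_slope : c.J = c.slope 1 := by
  have h := join_mem (L := L) (c.label_ne_oneZero 1)
  rw [J, slope, ← eq_join (c.label_ne_oneZero 1).symm h.2 h.1]

theorem J_mem_lineInf : c.J ∈ c.lineInf := c.J_eq_slope ▸ (c.slope_mem 1).2

theorem J_ne_X : c.J ≠ c.X := by
  rw [c.J_eq_slope, ← c.slope_zero]
  exact fun h => c.one_ne_zero' (c.slope_injective h)

theorem J_ne_Y : c.J ≠ c.Y := c.J_eq_slope ▸ c.slope_ne_Y 1

theorem J_notMem_OX : c.J ∉ join L c.O c.X := fun h => c.J_ne_X (c.eq_X c.J_mem_lineInf h)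

theorem J_notMem_OY : c.J ∉ join L c.O c.Y := by
  intro h
  obtain ⟨a, ha⟩ := c.exists_label h c.J_ne_Y
  exact c.label_notMem_lineInf a (ha ▸ c.J_mem_lineInf)

theorem label_ne_J (a : R) : c.label a ≠ c.J := fun h =>
  c.label_notMem_lineInf a (h ▸ c.J_mem_lineInf)

theorem ptX_mem (a : R) : c.ptX a ∈ join L (c.label a) c.J ∧ c.ptX a ∈ join L c.O c.X :=
  meet_mem fun h => c.J_notMem_OX (h ▸ (join_mem (c.label_ne_J a)).2)

theorem ptX_notMem_lineInf (a : R) : c.ptX a ∉ c.lineInf := by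
  intro h
  have e := c.eq_X h (c.ptX_mem a).2
  have := line_unique c.J_ne_X (join_mem (c.label_ne_J a)).2 (e ▸ (c.ptX_mem a).1)
    c.J_mem_lineInf c.X_mem_lineInf
  exact c.label_notMem_lineInf a (this ▸ (join_mem (c.label_ne_J a)).1)

theorem ptX_ne_J (a : R) : c.ptX a ≠ c.J := fun h => c.J_notMem_OX (h ▸ (c.ptX_mem a).2)

/-- Projection from `J` is a perspectivity from `OY` to `OX` that sends `Y` to `X`, because `J` lies
on `XY`; `exists_ptX` is its surjectivity. -/
theorem ptX_injective : Function.Injective c.ptX := by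
  intro a b h
  have hl := line_unique (c.ptX_ne_J a) (c.ptX_mem a).1
    (join_mem (c.label_ne_J a)).2 (h ▸ (c.ptX_mem b).1) (join_mem (c.label_ne_J b)).2
  refine c.label_injective (point_unique (l := join L (c.label a) c.J) ?_
    (join_mem (c.label_ne_J a)).1 (hl ▸ (join_mem (c.label_ne_J b)).1)
    (c.label_mem a) (c.label_mem b))
  exact fun e => c.J_notMem_OY (e ▸ (join_mem (c.label_ne_J a)).2)

theorem exists_ptX {A : P} (h : A ∈ join L c.O c.X) (hA : A ≠ c.X) : ∃ a, c.ptX a = A := by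
  have hAi : A ∉ c.lineInf := fun h' => hA (c.eq_X h' h)
  have hA1 : A ≠ c.J := fun e => hAi (e ▸ c.J_mem_lineInf)
  obtain ⟨hl1, hl2⟩ := join_mem (L := L) hA1
  have hne : join L A c.J ≠ join L c.O c.Y := fun e => c.J_notMem_OY (e ▸ hl2)
  have hne' : join L A c.J ≠ c.lineInf := fun e => hAi (e ▸ hl1)
  obtain ⟨h1, h2⟩ := meet_mem (P := P) hne
  obtain ⟨a, ha⟩ := c.exists_label h2 fun e =>
    c.J_ne_Y (point_unique hne' hl2 (e ▸ h1) c.J_mem_lineInf c.Y_mem_lineInf)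
  refine ⟨a, ?_⟩
  have e := eq_join (c.label_ne_J a) (ha ▸ h1) hl2
  exact point_unique (fun (e' : join L A c.J = join L c.O c.X) => c.J_notMem_OX (e' ▸ hl2))
    (e ▸ (c.ptX_mem a).1) hl1 (c.ptX_mem a).2 h

theorem ptX_zero : c.ptX 0 = c.O := by
  have h : c.O ≠ c.J := c.label_zero ▸ c.label_ne_J 0
  refine point_unique (l := join L (c.label 0) c.J) ?_ (c.ptX_mem 0).1
    (c.label_zero ▸ (join_mem (c.label_ne_J 0)).1) (c.ptX_mem 0).2 (join_mem c.O_ne_X).1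
  exact fun e => c.J_notMem_OX (e ▸ (join_mem (c.label_ne_J 0)).2)

/-- The points `(0, 1)`, `(1, 0)` and `J` are collinear by the choice of `J`. -/
theorem ptX_one : c.ptX 1 = c.oneZero := by
  refine point_unique (l := join L (c.label 1) c.J) ?_ (c.ptX_mem 1).1 ?_ (c.ptX_mem 1).2
    c.oneZero_mem.2
  · exact fun e => c.J_notMem_OX (e ▸ (join_mem (c.label_ne_J 1)).2)
  · rw [← eq_join (l := join L (c.label 1) c.oneZero) (c.label_ne_J 1)
      (join_mem (c.label_ne_oneZero 1)).1 (c.J_eq_slope ▸ (c.slope_mem 1).1)]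
    exact (join_mem (c.label_ne_oneZero 1)).2

theorem ptX_ne_Y (a : R) : c.ptX a ≠ c.Y := fun h => c.Y_notMem_OX (h ▸ (c.ptX_mem a).2)

theorem ptX_mem_vline (a : R) : c.ptX a ∈ c.vline a := (join_mem (c.ptX_ne_Y a)).1

theorem Y_mem_vline (a : R) : c.Y ∈ c.vline a := (join_mem (c.ptX_ne_Y a)).2

theorem vline_ne_lineInf (a : R) : c.vline a ≠ c.lineInf := fun h =>
  c.ptX_notMem_lineInf a (h ▸ c.ptX_mem_vline a)

theorem vline_zero : c.vline 0 = join L c.O c.Y := by rw [vline, ptX_zero]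

theorem vline_injective : Function.Injective c.vline := by
  intro a b h
  refine c.ptX_injective (point_unique (fun e => ?_) (c.ptX_mem_vline a)
    (h ▸ c.ptX_mem_vline b) (c.ptX_mem a).2 (c.ptX_mem b).2)
  exact c.Y_notMem_OX (e ▸ c.Y_mem_vline a)

theorem exists_vline {l : L} (h : c.Y ∈ l) (hl : l ≠ c.lineInf) : ∃ a, c.vline a = l := by
  have hne : l ≠ join L c.O c.X := fun e => c.Y_notMem_OX (e ▸ h)
  obtain ⟨h1, h2⟩ := meet_mem (P := P) hne
  obtain ⟨a, ha⟩ := c.exists_ptX h2 fun e =>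
    hl (line_unique c.X_ne_Y (e ▸ h1) h c.X_mem_lineInf c.Y_mem_lineInf)
  exact ⟨a, (eq_join (c.ptX_ne_Y a) (ha ▸ h1) h).symm⟩

theorem slope_ne_label (m k : R) : c.slope m ≠ c.label k := fun h =>
  c.label_notMem_lineInf k (h ▸ (c.slope_mem m).2)

theorem slope_mem_line (m k : R) : c.slope m ∈ c.line m k := (join_mem (c.slope_ne_label m k)).1

theorem label_mem_line (m k : R) : c.label k ∈ c.line m k := (join_mem (c.slope_ne_label m k)).2

theorem line_ne_lineInf (m k : R) : c.line m k ≠ c.lineInf := fun h =>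
  c.label_notMem_lineInf k (h ▸ c.label_mem_line m k)

theorem Y_notMem_line (m k : R) : c.Y ∉ c.line m k := fun h =>
  c.slope_ne_Y m (point_unique (c.line_ne_lineInf m k) (c.slope_mem_line m k) h (c.slope_mem m).2
    c.Y_mem_lineInf)

theorem slope_mem_line_iff {m n k : R} : c.slope n ∈ c.line m k ↔ n = m := by
  refine ⟨fun h => c.slope_injective ?_, fun h => h ▸ c.slope_mem_line m k⟩
  exact point_unique (c.line_ne_lineInf m k) h (c.slope_mem_line m k) (c.slope_mem n).2
    (c.slope_mem m).2

theorem label_mem_line_iff {m k y : R} : c.label y ∈ c.line m k ↔ y = k := by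
  refine ⟨fun h => c.label_injective ?_, fun h => h ▸ c.label_mem_line m y⟩
  exact point_unique (fun (e : c.line m k = join L c.O c.Y) =>
    c.Y_notMem_line m k (e ▸ (join_mem c.O_ne_Y).2)) h
    (c.label_mem_line m k) (c.label_mem y) (c.label_mem k)

/-- A line missing `(∞)` meets `[∞]` and `OY` in labelled points, which provide the slope and the
intercept. -/
theorem exists_line {l : L} (h : c.Y ∉ l) : ∃ m k, c.line m k = l := by
  obtain ⟨h1, h2⟩ := meet_mem (P := P) (l := l) (m := c.lineInf)
    fun e => h (e ▸ c.Y_mem_lineInf)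
  obtain ⟨h3, h4⟩ := meet_mem (P := P) (l := l) (m := join L c.O c.Y)
    fun e => h (e ▸ (join_mem c.O_ne_Y).2)
  obtain ⟨m, hm⟩ := c.exists_slope h2 fun e => h (e ▸ h1)
  obtain ⟨k, hk⟩ := c.exists_label h4 fun e => h (e ▸ h3)
  exact ⟨m, k, (eq_join (c.slope_ne_label m k) (hm ▸ h1) (hk ▸ h3)).symm⟩

theorem line_zero_eq (k : R) : c.line 0 k = join L (c.label k) c.X := by
  have h : c.label k ≠ c.X := (c.slope_zero ▸ c.slope_ne_label 0 k).symm
  exact eq_join h (c.label_mem_line 0 k) (c.slope_zero ▸ c.slope_mem_line 0 k)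

theorem line_zero_zero : c.line 0 0 = join L c.O c.X := by
  rw [line_zero_eq, label_zero]

theorem pt_mem (a b : R) : c.pt a b ∈ c.vline a ∧ c.pt a b ∈ c.line 0 b := by
  rw [line_zero_eq]
  refine meet_mem fun h => ?_
  rw [← line_zero_eq] at h
  exact c.Y_notMem_line 0 b (h ▸ c.Y_mem_vline a)

theorem pt_notMem_lineInf (a b : R) : c.pt a b ∉ c.lineInf := by
  intro h
  have e := point_unique (c.vline_ne_lineInf a) (c.pt_mem a b).1 (c.Y_mem_vline a) h
    c.Y_mem_lineInf
  exact c.Y_notMem_line 0 b (e ▸ (c.pt_mem a b).2)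

theorem pt_mem_vline_iff {a b x : R} : c.pt a b ∈ c.vline x ↔ a = x := by
  refine ⟨fun h => c.vline_injective ?_, fun h => h ▸ (c.pt_mem a b).1⟩
  exact line_unique (fun (e : c.pt a b = c.Y) => c.pt_notMem_lineInf a b (e ▸ c.Y_mem_lineInf))
    (c.pt_mem a b).1 (c.Y_mem_vline a) h (c.Y_mem_vline x)

theorem pt_mem_line_zero_iff {a b k : R} : c.pt a b ∈ c.line 0 k ↔ b = k := by
  refine ⟨fun h => ?_, fun h => h ▸ (c.pt_mem a b).2⟩
  have e := line_unique (fun (e : c.pt a b = c.slope 0) =>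
    c.pt_notMem_lineInf a b (e ▸ (c.slope_mem 0).2)) h
    (c.slope_mem_line 0 k) (c.pt_mem a b).2 (c.slope_mem_line 0 b)
  exact c.label_mem_line_iff.1 (e ▸ c.label_mem_line 0 b)

theorem pt_inj {a b x y : R} : c.pt a b = c.pt x y ↔ a = x ∧ b = y :=
  ⟨fun h => ⟨c.pt_mem_vline_iff.1 (h ▸ (c.pt_mem x y).1),
    c.pt_mem_line_zero_iff.1 (h ▸ (c.pt_mem x y).2)⟩, fun h => by rw [h.1, h.2]⟩

theorem eq_pt {A : P} {x y : R} (hx : A ∈ c.vline x) (hy : A ∈ c.line 0 y) : A = c.pt x y :=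
  point_unique (fun (e : _ = c.line 0 y) => c.Y_notMem_line 0 y (e ▸ c.Y_mem_vline x)) hx (c.pt_mem x y).1 hy
    (c.pt_mem x y).2

theorem exists_pt {A : P} (h : A ∉ c.lineInf) : ∃ x y, c.pt x y = A := by
  have hY : A ≠ c.Y := fun e => h (e ▸ c.Y_mem_lineInf)
  have hX : A ≠ c.X := fun e => h (e ▸ c.X_mem_lineInf)
  obtain ⟨x, hx⟩ := c.exists_vline (join_mem (L := L) hY).2 fun e => h (e ▸ (join_mem hY).1)
  obtain ⟨m, y, hy⟩ := c.exists_line (l := join L A c.X) fun e => h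
    (line_unique c.X_ne_Y (join_mem hX).2 e c.X_mem_lineInf c.Y_mem_lineInf ▸ (join_mem hX).1)
  have hm : 0 = m := (c.slope_mem_line_iff (k := y)).1 (c.slope_zero ▸ hy ▸ (join_mem hX).2)
  subst hm
  exact ⟨x, y, (c.eq_pt (hx ▸ (join_mem hY).1) (hy ▸ (join_mem hX).1)).symm⟩

theorem pt_zero_left (b : R) : c.pt 0 b = c.label b :=
  (c.eq_pt (c.vline_zero ▸ c.label_mem b) (c.label_mem_line 0 b)).symm

theorem pt_zero_right (a : R) : c.pt a 0 = c.ptX a :=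
  (c.eq_pt (c.ptX_mem_vline a) (c.line_zero_zero ▸ (c.ptX_mem a).2)).symm

theorem pt_one_zero_mem_line (m : R) : c.pt 1 0 ∈ c.line m m := by
  rw [pt_zero_right, ptX_one]
  have h := join_mem (L := L) (c.label_ne_oneZero m)
  rw [line, ← eq_join (c.slope_ne_label m m) (c.slope_mem m).1 h.1]
  exact h.2

/-- A collineation that fixes `(∞)` and `[∞]` acts on coordinates. -/
theorem exists_coordinate_action {g : Equiv.Perm P × Equiv.Perm L}
    (hg : g ∈ collineationGroup P L) (hY : g.1 c.Y = c.Y) (hinf : g.2 c.lineInf = c.lineInf) :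
    ∃ (σ μ : R → R) (ρ κ : R → R → R), (∀ x, g.2 (c.vline x) = c.vline (σ x)) ∧
      (∀ m, g.1 (c.slope m) = c.slope (μ m)) ∧
      (∀ x y, g.1 (c.pt x y) = c.pt (σ x) (ρ x y)) ∧
      (∀ m k, g.2 (c.line m k) = c.line (μ m) (κ m k)) := by
  have hg' : ∀ (A : P) (l : L), g.1 A ∈ g.2 l ↔ A ∈ l := hg
  -- The lines through `(∞)` other than `[∞]` are permuted, and so are the points of `[∞]` other
  -- than `(∞)`; hence the new abscissa depends only on `x` and the new slope only on `m`.
  have h1 : ∀ x, ∃ x', g.2 (c.vline x) = c.vline x' := fun x => by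
    obtain ⟨x', h⟩ := c.exists_vline (l := g.2 (c.vline x)) (by
      rw [← hY, hg']; exact c.Y_mem_vline x) (by
      rw [← hinf]; exact fun h => c.vline_ne_lineInf x (g.2.injective h))
    exact ⟨x', h.symm⟩
  have h2 : ∀ m, ∃ m', g.1 (c.slope m) = c.slope m' := fun m => by
    obtain ⟨m', h⟩ := c.exists_slope (A := g.1 (c.slope m)) (by
      rw [← hinf, hg']; exact (c.slope_mem m).2) (by
      rw [← hY]; exact fun h => c.slope_ne_Y m (g.1.injective h))
    exact ⟨m', h.symm⟩
  choose σ hσ using h1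
  choose μ hμ using h2
  have h3 : ∀ x y, ∃ y', g.1 (c.pt x y) = c.pt (σ x) y' := fun x y => by
    obtain ⟨x', y', h⟩ := c.exists_pt (A := g.1 (c.pt x y)) (by
      rw [← hinf, hg']; exact c.pt_notMem_lineInf x y)
    have : c.pt x' y' ∈ c.vline (σ x) := by rw [h, ← hσ, hg']; exact (c.pt_mem x y).1
    rw [c.pt_mem_vline_iff] at this
    exact ⟨y', this ▸ h.symm⟩
  have h4 : ∀ m k, ∃ k', g.2 (c.line m k) = c.line (μ m) k' := fun m k => by
    obtain ⟨m', k', h⟩ := c.exists_line (l := g.2 (c.line m k)) (by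
      rw [← hY, hg']; exact c.Y_notMem_line m k)
    have : c.slope (μ m) ∈ c.line m' k' := by rw [h, ← hμ, hg']; exact c.slope_mem_line m k
    rw [c.slope_mem_line_iff] at this
    exact ⟨k', this ▸ h.symm⟩
  choose ρ hρ using h3
  choose κ hκ using h4
  exact ⟨σ, μ, ρ, κ, hσ, hμ, hρ, hκ⟩

/-- `t` is the planar ternary ring of the coordinatisation. -/
def IsTernary (t : R → R → R → R) : Prop := ∀ m x y k : R, t m x y = k ↔ c.pt x y ∈ c.line m k

variable {c} {t : R → R → R → R}

/-! ### The ternary operation and the central collineations acting on it. -/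

namespace IsTernary

theorem zero_left (ht : c.IsTernary t) (x y : R) : t 0 x y = y :=
  (ht _ _ _ _).2 (c.pt_mem x y).2

theorem zero_mid (ht : c.IsTernary t) (m y : R) : t m 0 y = y :=
  (ht _ _ _ _).2 (c.pt_zero_left y ▸ c.label_mem_line m y)

theorem one_zero (ht : c.IsTernary t) (m : R) : t m 1 0 = m :=
  (ht _ _ _ _).2 (c.pt_one_zero_mem_line m)

/-- A line of nonzero slope meets `OX` only once. Together with `injective_left` this yields the
permutations behind the vanishing at exponent `q - 1`. -/
theorem injective_mid (ht : c.IsTernary t) {m : R} (hm : m ≠ 0) :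
    Function.Injective fun x => t m x 0 := by
  intro x x' h
  have h1 := (ht m x 0 _).1 h
  have h2 := (ht m x' 0 _).1 rfl
  refine (c.pt_inj.1 (point_unique (fun e => hm ?_) h1 h2 (c.pt_mem x 0).2 (c.pt_mem x' 0).2)).1
  exact c.slope_mem_line_iff.1 (e ▸ c.slope_mem_line m _)

theorem injective_left (ht : c.IsTernary t) {x : R} (hx : x ≠ 0) :
    Function.Injective fun m => t m x 0 := by
  intro m m' h
  have h1 := (ht m x 0 _).1 h
  have h2 := (ht m' x 0 _).1 rfl
  have e := line_unique (fun e => hx (c.pt_inj.1 (e.trans (c.pt_zero_left _).symm)).1) h1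
    (c.label_mem_line m _) h2 (c.label_mem_line m' _)
  exact c.slope_mem_line_iff.1 (e ▸ c.slope_mem_line m _)

theorem map_coordinates (ht : c.IsTernary t) {g : Equiv.Perm P × Equiv.Perm L}
    (hg : g ∈ collineationGroup P L) {σ μ : R → R} {ρ κ : R → R → R}
    (hρ : ∀ x y, g.1 (c.pt x y) = c.pt (σ x) (ρ x y))
    (hκ : ∀ m k, g.2 (c.line m k) = c.line (μ m) (κ m k)) (m x y : R) :
    t (μ m) (σ x) (ρ x y) = κ m (t m x y) := by
  rw [ht, ← hρ, ← hκ]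
  exact (hg _ _).2 ((ht _ _ _ _).1 rfl)

/-- Such an elation fixes all slopes and all vertical lines, so it only moves ordinates. Horizontal
lines show that this motion does not depend on the abscissa, and the points of `[0]` show that it
moves the intercepts of all slopes alike. -/
theorem exists_shift_of_transitive (ht : c.IsTernary t) (h : IsTransitive c.Y c.lineInf) (a : R) :
    ∃ τ : R → R, τ 0 = a ∧ ∀ m x y, t m x (τ y) = τ (t m x y) := by
  by_cases ha : a = 0
  · exact ⟨id, ha.symm, fun _ _ _ => rfl⟩
  obtain ⟨g, ⟨hg, hgp, hgl⟩, hga⟩ := h (c.pt 0 0) (c.pt 0 a) (fun e => ha (c.pt_inj.1 e).2.symm)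
    ⟨c.vline 0, c.Y_mem_vline 0, (c.pt_mem _ _).1, (c.pt_mem _ _).1⟩
    (fun e => c.pt_notMem_lineInf _ _ (e ▸ c.Y_mem_lineInf))
    (fun e => c.pt_notMem_lineInf _ _ (e ▸ c.Y_mem_lineInf)) (c.pt_notMem_lineInf _ _)
    (c.pt_notMem_lineInf _ _)
  obtain ⟨σ, μ, ρ, κ, hσ, hμ, hρ, hκ⟩ := c.exists_coordinate_action hg (hgp _ c.Y_mem_lineInf)
    (hgl _ c.Y_mem_lineInf)
  have key := ht.map_coordinates hg hρ hκ
  have hσ' : ∀ x, σ x = x := fun x =>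
    c.vline_injective ((hσ x).symm.trans (hgl _ (c.Y_mem_vline x)))
  have hμ' : ∀ m, μ m = m := fun m =>
    c.slope_injective ((hμ m).symm.trans (hgp _ (c.slope_mem m).2))
  simp only [hσ', hμ'] at key hρ
  have h1 : ∀ x y, ρ x y = κ 0 y := fun x y => by simpa only [ht.zero_left] using key 0 x y
  have h2 : ∀ m y, κ 0 y = κ m y := fun m y => by
    rw [← h1 0 y]; simpa only [ht.zero_mid] using key m 0 y
  refine ⟨κ 0, ?_, fun m x y => ?_⟩
  · rw [← h1 0 0]
    rw [hρ] at hga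
    exact (c.pt_inj.1 hga).2
  · rw [h2 m (t m x y), ← key m x y, h1]

/-- A homology with axis `[0]` and center `(0)` fixes every intercept and every horizontal line, so
ordinates stay put and only slopes and abscissas change. -/
theorem exists_of_transitive_zero (ht : c.IsTernary t)
    (h : IsTransitive (c.slope 0) (c.vline 0)) {a : R} (ha : a ≠ 0) :
    ∃ σ μ : R → R, σ 1 = a ∧ Function.Surjective μ ∧ ∀ m x y, t (μ m) (σ x) y = t m x y := by
  by_cases ha1 : a = 1
  · exact ⟨id, id, ha1.symm, Function.surjective_id, fun _ _ _ => rfl⟩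
  have hX : ∀ x y, c.pt x y ≠ c.slope 0 := fun x y e =>
    c.pt_notMem_lineInf _ _ (e ▸ (c.slope_mem 0).2)
  obtain ⟨g, ⟨hg, hgp, hgl⟩, hga⟩ := h (c.pt 1 0) (c.pt a 0)
    (fun e => ha1 (c.pt_inj.1 e).1.symm)
    ⟨c.line 0 0, c.slope_mem_line 0 0, (c.pt_mem _ _).2, (c.pt_mem _ _).2⟩ (hX _ _) (hX _ _)
    (fun e => c.one_ne_zero' (c.pt_mem_vline_iff.1 e)) (fun e => ha (c.pt_mem_vline_iff.1 e))
  have hY := hgp _ (c.Y_mem_vline 0)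
  have hinf := hgl _ (c.slope_mem 0).2
  obtain ⟨σ, μ, ρ, κ, hσ, hμ, hρ, hκ⟩ := c.exists_coordinate_action hg hY hinf
  have key := ht.map_coordinates hg hρ hκ
  have h0 : ∀ y, σ 0 = 0 ∧ ρ 0 y = y := fun y =>
    c.pt_inj.1 ((hρ 0 y).symm.trans (hgp _ (c.pt_mem 0 y).1))
  have h1 : ∀ m y, κ m y = y := fun m y => by
    rw [← ht.zero_mid m y, ← key, (h0 y).1, (h0 y).2, ht.zero_mid, ht.zero_mid]
  have hμ0 : μ 0 = 0 :=
    (c.slope_mem_line_iff (k := 0)).1 (by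
      rw [← hμ, ← hgl _ (c.slope_mem_line 0 0)]
      exact (hg _ _).2 (c.slope_mem_line 0 0))
  have h2 : ∀ x y, ρ x y = y := fun x y => by
    have := key 0 x y
    rwa [hμ0, ht.zero_left, ht.zero_left, h1] at this
  simp only [h1, h2] at key
  refine ⟨σ, μ, ?_, fun m => ?_, key⟩
  · rw [hρ] at hga
    exact (c.pt_inj.1 hga).1
  · have hS : g.1 (g.1.symm (c.slope m)) = c.slope m := g.1.apply_symm_apply _
    obtain ⟨n, hn⟩ := c.exists_slope (A := g.1.symm (c.slope m))
      ((hg _ _).1 (by rw [hS, hinf]; exact (c.slope_mem m).2))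
      (fun e => c.slope_ne_Y m (by rw [← hS, e, hY]))
    exact ⟨n, c.slope_injective (by rw [← hμ, hn, hS])⟩

/-- The axis `[∞]` fixes the slopes and the center `(0)` fixes the horizontal lines, hence the
ordinates. -/
theorem exists_of_transitive_slope_zero (ht : c.IsTernary t)
    (h : IsTransitive (c.slope 0) c.lineInf) (a : R) :
    ∃ (σ : R → R) (κ : R → R → R), σ 0 = a ∧ ∀ m x y, t m (σ x) y = κ m (t m x y) := by
  by_cases ha : a = 0
  · exact ⟨id, fun _ => id, ha.symm, fun _ _ _ => rfl⟩
  have hX : ∀ x y, c.pt x y ≠ c.slope 0 := fun x y e =>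
    c.pt_notMem_lineInf _ _ (e ▸ (c.slope_mem 0).2)
  obtain ⟨g, ⟨hg, hgp, hgl⟩, hga⟩ := h (c.pt 0 0) (c.pt a 0) (fun e => ha (c.pt_inj.1 e).1.symm)
    ⟨c.line 0 0, c.slope_mem_line 0 0, (c.pt_mem _ _).2, (c.pt_mem _ _).2⟩ (hX _ _) (hX _ _)
    (c.pt_notMem_lineInf _ _) (c.pt_notMem_lineInf _ _)
  obtain ⟨σ, μ, ρ, κ, hσ, hμ, hρ, hκ⟩ := c.exists_coordinate_action hg (hgp _ c.Y_mem_lineInf)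
    (hgl _ (c.slope_mem 0).2)
  have key := ht.map_coordinates hg hρ hκ
  have hμ' : ∀ m, μ m = m := fun m =>
    c.slope_injective ((hμ m).symm.trans (hgp _ (c.slope_mem m).2))
  have hρ' : ∀ x y, ρ x y = y := fun x y => by
    rw [← c.pt_mem_line_zero_iff (a := σ x), ← hρ, ← hgl _ (c.slope_mem_line 0 y)]
    exact (hg _ _).2 (c.pt_mem x y).2
  simp only [hμ', hρ'] at key
  refine ⟨σ, κ, ?_, key⟩
  rw [hρ] at hga
  exact (c.pt_inj.1 hga).1

/-- The center `(∞)` fixes the abscissas and the axis `[0]` fixes the intercepts. The elation is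
chosen by its effect on `[∞]`, a line through the center: it moves `(0)` to `(s)`. -/
theorem exists_of_transitive_vline_zero (ht : c.IsTernary t)
    (h : IsTransitive c.Y (c.vline 0)) (s : R) :
    ∃ (μ : R → R) (ρ : R → R → R), μ 0 = s ∧ ∀ m x y, t (μ m) x (ρ x y) = t m x y := by
  by_cases hs : s = 0
  · exact ⟨id, fun _ => id, hs.symm, fun _ _ _ => rfl⟩
  have hX : ∀ m, c.slope m ∉ c.vline 0 := fun m e => c.slope_ne_Y m
    (point_unique (c.vline_ne_lineInf 0) e (c.Y_mem_vline 0) (c.slope_mem m).2 c.Y_mem_lineInf)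
  obtain ⟨g, ⟨hg, hgp, hgl⟩, hgs⟩ := h (c.slope 0) (c.slope s)
    (fun e => hs (c.slope_injective e).symm)
    ⟨c.lineInf, c.Y_mem_lineInf, (c.slope_mem _).2, (c.slope_mem _).2⟩ (c.slope_ne_Y _)
    (c.slope_ne_Y _) (hX _) (hX _)
  obtain ⟨σ, μ, ρ, κ, hσ, hμ, hρ, hκ⟩ := c.exists_coordinate_action hg (hgp _ (c.Y_mem_vline 0))
    (hgl _ c.Y_mem_lineInf)
  have key := ht.map_coordinates hg hρ hκ
  have hσ' : ∀ x, σ x = x := fun x =>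
    c.vline_injective ((hσ x).symm.trans (hgl _ (c.Y_mem_vline x)))
  have h0 : ∀ y, ρ 0 y = y := fun y =>
    (c.pt_inj.1 ((hρ 0 y).symm.trans (hgp _ (c.pt_mem 0 y).1))).2
  have h1 : ∀ m y, κ m y = y := fun m y => by
    have := key m 0 y
    rw [hσ', h0, ht.zero_mid, ht.zero_mid] at this
    exact this.symm
  simp only [hσ', h1] at key
  refine ⟨μ, ρ, ?_, key⟩
  exact c.slope_injective (by rw [← hμ, hgs])

end IsTernary

end Basic
end Coordinatisation
-- Reduced polynomials over a finite field.
section ReducedPolynomials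

/-- Lucas' congruence strips one factor `p` from both entries at each step, down to `m.choose 1`. -/
theorem choose_prime_pow_mul_modEq {p : ℕ} (hp : p.Prime) (n m : ℕ) :
    (p ^ n * m).choose (p ^ n) ≡ m [MOD p] := by
  have := Fact.mk hp
  induction n with
  | zero => simp [Nat.ModEq.refl]
  | succ n ih =>
    refine Nat.ModEq.trans ?_ ih
    have := Choose.choose_modEq_choose_mod_mul_choose_div_nat (n := p * (p ^ n * m))
      (k := p * p ^ n) (p := p)
    rwa [Nat.mul_mod_right, Nat.mul_mod_right, Nat.choose_zero_right, one_mul,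
      Nat.mul_div_cancel_left _ hp.pos, Nat.mul_div_cancel_left _ hp.pos, ← mul_assoc,
      ← pow_succ'] at this

theorem eq_prime_pow_of_dvd_choose {p j : ℕ} (hp : p.Prime) (hj : j ≠ 0)
    (h : ∀ k, 0 < k → k < j → p ∣ j.choose k) : ∃ n, j = p ^ n := by
  obtain ⟨n, m, hm, rfl⟩ := Nat.exists_eq_pow_mul_and_not_dvd hj p hp.ne_one
  refine ⟨n, ?_⟩
  by_contra hne
  have hm0 : m ≠ 0 := by rintro rfl; simp at hm
  have hm1 : m ≠ 1 := by rintro rfl; simp at hne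
  have hpn : 0 < p ^ n := pow_pos hp.pos n
  -- With `j = p ^ n * m` and `m > 1`, the interior index `k = p ^ n` has binomial congruent to `m`,
  -- which `p` does not divide.
  have hlt : p ^ n < p ^ n * m := lt_mul_of_one_lt_right hpn (by omega)
  exact hm ((choose_prime_pow_mul_modEq hp n m).dvd_iff dvd_rfl |>.1 (h _ hpn hlt))

variable {F : Type*} [Field F]

/-- The polynomial of degree less than `n` with coefficients `b`. -/
noncomputable def truncatedPolynomial (n : ℕ) (b : ℕ → F) : Polynomial F :=
  ∑ i ∈ Finset.range n, Polynomial.monomial i (b i)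

theorem coeff_truncatedPolynomial (n : ℕ) (b : ℕ → F) (i : ℕ) :
    (truncatedPolynomial n b).coeff i = if i < n then b i else 0 := by
  simp [truncatedPolynomial, Polynomial.coeff_monomial]

theorem degree_truncatedPolynomial_lt (n : ℕ) (b : ℕ → F) :
    (truncatedPolynomial n b).degree < n := by
  rw [Polynomial.degree_lt_iff_coeff_zero]
  intro m hm
  rw [coeff_truncatedPolynomial, if_neg (by omega)]

theorem eval_truncatedPolynomial (n : ℕ) (b : ℕ → F) (x : F) :
    (truncatedPolynomial n b).eval x = ∑ i ∈ Finset.range n, b i * x ^ i := by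
  simp [truncatedPolynomial, Polynomial.eval_finsetSum]

/-- The polynomial in two variables, of degree less than `n` in each of them, with
coefficients `a`. -/
noncomputable def bivariate (n : ℕ) (a : ℕ → ℕ → F) : MvPolynomial (Fin 2) F :=
  ∑ i ∈ Finset.range n, ∑ j ∈ Finset.range n,
    MvPolynomial.C (a i j) * MvPolynomial.X 0 ^ i * MvPolynomial.X 1 ^ j

theorem eval_bivariate (n : ℕ) (a : ℕ → ℕ → F) (x y : F) :
    MvPolynomial.eval ![x, y] (bivariate n a) =
      ∑ i ∈ Finset.range n, ∑ j ∈ Finset.range n, a i j * x ^ i * y ^ j := by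
  simp [bivariate]

/-- One reindexing serves all displays: `u` and `v` are the identity or `i ↦ p ^ i`, and injectivity
prevents a monomial from being counted twice. -/
theorem bivariate_eq_sum {n : ℕ} {a : ℕ → ℕ → F} {u v : ℕ → ℕ} {s t : Finset ℕ}
    (hu : Function.Injective u) (hv : Function.Injective v) (hs : ∀ i ∈ s, u i < n)
    (ht : ∀ j ∈ t, v j < n)
    (h : ∀ i < n, ∀ j < n, a i j ≠ 0 → (∃ k ∈ s, u k = i) ∧ ∃ k ∈ t, v k = j) :
    bivariate n a = ∑ i ∈ s, ∑ j ∈ t, MvPolynomial.C (a (u i) (v j)) * MvPolynomial.X 0 ^ (u i) *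
      MvPolynomial.X 1 ^ (v j) := by
  symm
  refine Finset.sum_of_injOn u hu.injOn (fun i hi => by simpa using hs i hi) ?_ ?_
  · intro i hi hni
    refine Finset.sum_eq_zero fun j hj => ?_
    by_cases ha : a i j = 0
    · simp [ha]
    · exact absurd (h i (Finset.mem_range.1 hi) j (Finset.mem_range.1 hj) ha).1 hni
  · intro i hi
    refine Finset.sum_of_injOn v hv.injOn (fun j hj => by simpa using ht j hj) ?_ fun _ _ => rfl
    intro j hj hnj
    by_cases ha : a (u i) j = 0
    · simp [ha]
    · exact absurd (h _ (hs i hi) j (Finset.mem_range.1 hj) ha).2 hnj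

variable [Fintype F]

local notation "q" => Fintype.card F

theorem polynomial_ext_of_degree_lt {f g : Polynomial F} (hf : f.degree < q) (hg : g.degree < q)
    (h : ∀ x, f.eval x = g.eval x) : f = g :=
  Polynomial.eq_of_degrees_lt_of_eval_finset_eq Finset.univ (by simpa using hf) (by simpa using hg)
    fun x _ => h x

theorem exists_reduced (φ : F → F) : ∃ b : ℕ → F, ∀ x, φ x = ∑ i ∈ Finset.range q, b i * x ^ i := by
  classical
  have hinj : Set.InjOn (id : F → F) (Finset.univ : Finset F) := Function.injective_id.injOn
  have hd : (Lagrange.interpolate Finset.univ id φ).natDegree < q := by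
    have h := Lagrange.degree_interpolate_lt φ hinj
    rw [Finset.card_univ] at h
    by_cases h0 : Lagrange.interpolate Finset.univ id φ = 0
    · rw [h0, Polynomial.natDegree_zero]; exact Fintype.card_pos
    · exact (Polynomial.natDegree_lt_iff_degree_lt h0).2 h
  refine ⟨(Lagrange.interpolate Finset.univ id φ).coeff, fun x => ?_⟩
  rw [← Polynomial.eval_eq_sum_range' hd]
  exact (Lagrange.eval_interpolate_at_node φ hinj (Finset.mem_univ x)).symm

theorem coeff_eq_zero_of_forall_sum_eq_zero {b : ℕ → F}
    (h : ∀ x, ∑ i ∈ Finset.range q, b i * x ^ i = 0) {i : ℕ} (hi : i < q) : b i = 0 := by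
  have : truncatedPolynomial q b = 0 :=
    polynomial_ext_of_degree_lt (degree_truncatedPolynomial_lt _ _)
      (by rw [Polynomial.degree_zero]; exact WithBot.bot_lt_coe _)
      fun x => by rw [eval_truncatedPolynomial, h, Polynomial.eval_zero]
  have h2 := coeff_truncatedPolynomial q b i
  rw [this, if_pos hi] at h2
  exact h2.symm

/-- `b` gives the coefficients of the reduced polynomial of `φ`. -/
def IsReduced (b : ℕ → F) (φ : F → F) : Prop :=
  ∀ x, φ x = ∑ i ∈ Finset.range q, b i * x ^ i

namespace IsReduced

variable {b : ℕ → F} {φ : F → F}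

theorem coeff_zero (h : IsReduced b φ) (h0 : φ 0 = 0) : b 0 = 0 := by
  rw [h 0, Finset.sum_eq_single_of_mem 0 (Finset.mem_range.2 Fintype.card_pos)
    (fun i _ hi => by rw [zero_pow hi, mul_zero])] at h0
  simpa using h0

/-- The power sums over the field vanish for exponents below `q - 1`, so the sum of all values of
`φ` is `-b (q - 1)`. -/
theorem coeff_card_sub_one (h : IsReduced b φ) (h0 : ∑ x, φ x = 0) : b (q - 1) = 0 := by
  have hq : 1 < q := Fintype.one_lt_card
  have e : ∑ x, φ x = ∑ i ∈ Finset.range q, b i * ∑ x : F, x ^ i := by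
    simp_rw [h _, Finset.mul_sum]
    exact Finset.sum_comm
  have hlast : ∑ x : F, x ^ (q - 1) = -1 := by
    classical
    -- The power is the indicator of `x ≠ 0`, so the sum is `q - 1`, that is `-1` in `F`.
    have h1 : ∀ x : F, x ^ (q - 1) = 1 - if x = 0 then 1 else 0 := fun x => by
      split_ifs with hx
      · rw [hx, zero_pow (by omega), sub_self]
      · rw [FiniteField.pow_card_sub_one_eq_one x hx, sub_zero]
    simp_rw [h1, Finset.sum_sub_distrib]
    simp
  rw [h0, Finset.sum_eq_single_of_mem (q - 1) (Finset.mem_range.2 (by omega)), hlast] at e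
  · simpa using e.symm
  · intro i hi hne
    have := Finset.mem_range.1 hi
    rw [FiniteField.sum_pow_lt_card_sub_one F i (by omega), mul_zero]

/-- Additivity makes `f(X + r) - f(X)` a constant for each `r`. The Hasse derivative of order `k >
0` at `r` is the coefficient of `X ^ k` in `f(X + r)`, hence independent of `r`; so it is a constant
polynomial and its higher coefficients vanish. -/
theorem choose_mul_coeff (h : IsReduced b φ) (hadd : ∀ x y, φ (x + y) = φ x + φ y) {j k : ℕ}
    (hk : 0 < k) (hkj : k < j) (hj : j < q) : (j.choose k : F) * b j = 0 := by
  set f := truncatedPolynomial q b with hf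
  have hd : f.degree < q := degree_truncatedPolynomial_lt _ _
  have hev : ∀ x, f.eval x = φ x := fun x => by rw [hf, eval_truncatedPolynomial, ← h x]
  have hC : ∀ r : F, (Polynomial.C r).degree < (q : WithBot ℕ) := fun r =>
    Polynomial.degree_C_le.trans_lt (by exact_mod_cast Fintype.card_pos)
  have htaylor : ∀ r, Polynomial.taylor r f = f + Polynomial.C (φ r) := fun r =>
    polynomial_ext_of_degree_lt (by rwa [Polynomial.degree_taylor])
      ((Polynomial.degree_add_le _ _).trans_lt (max_lt hd (hC _)))
      fun x => by rw [Polynomial.taylor_eval, Polynomial.eval_add, Polynomial.eval_C, hev, hev, hadd]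
  have hh : Polynomial.hasseDeriv k f = Polynomial.C (f.coeff k) := by
    refine polynomial_ext_of_degree_lt ?_ (hC _) fun r => ?_
    · rw [Polynomial.degree_lt_iff_coeff_zero] at hd ⊢
      intro m hm
      rw [Polynomial.hasseDeriv_coeff, hd _ (by omega), mul_zero]
    · rw [← Polynomial.taylor_coeff, htaylor, Polynomial.coeff_add, Polynomial.coeff_C,
        if_neg hk.ne', add_zero, Polynomial.eval_C]
  -- Since `j - k > 0`, the constant on the right contributes 0.
  have h2 := congrArg (fun g => Polynomial.coeff g (j - k)) hh
  simp only [Polynomial.hasseDeriv_coeff, Polynomial.coeff_C] at h2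
  rwa [if_neg (by omega), Nat.sub_add_cancel hkj.le, hf, coeff_truncatedPolynomial, if_pos hj] at h2

theorem exists_eq_prime_pow (h : IsReduced b φ) (hadd : ∀ x y, φ (x + y) = φ x + φ y) {p e : ℕ}
    (hp : p.Prime) (hF : q = p ^ e) {j : ℕ} (hj : j < q) (hb : b j ≠ 0) : ∃ n < e, p ^ n = j := by
  have := Fact.mk hp
  have : CharP F p := charP_of_card_eq_prime_pow hF
  have hj0 : j ≠ 0 := by
    rintro rfl
    exact hb (h.coeff_zero (by simpa using hadd 0 0))
  obtain ⟨n, rfl⟩ := eq_prime_pow_of_dvd_choose hp hj0 fun k hk hkj => by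
    rw [← CharP.cast_eq_zero_iff F p]
    exact (mul_eq_zero.1 (h.choose_mul_coeff hadd hk hkj hj)).resolve_right hb
  rw [hF] at hj
  exact ⟨n, (Nat.pow_lt_pow_iff_right hp.one_lt).1 hj, rfl⟩

end IsReduced

/-- `a` gives the coefficients of the reduced polynomial of `f` in two variables. -/
def IsReducedTwo (a : ℕ → ℕ → F) (f : F → F → F) : Prop :=
  ∀ x y, f x y = ∑ i ∈ Finset.range q, ∑ j ∈ Finset.range q, a i j * x ^ i * y ^ j

theorem exists_isReducedTwo (f : F → F → F) : ∃ a, IsReducedTwo a f := by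
  choose b hb using fun x => exists_reduced (f x)
  choose a ha using fun j => exists_reduced fun x => b x j
  refine ⟨fun i j => a j i, fun x y => ?_⟩
  rw [hb x y, Finset.sum_comm]
  exact Finset.sum_congr rfl fun j _ => by rw [ha j x, Finset.sum_mul]

namespace IsReducedTwo

variable {a : ℕ → ℕ → F} {f : F → F → F}

theorem flip (h : IsReducedTwo a f) : IsReducedTwo (fun i j => a j i) (fun x y => f y x) := by
  intro x y
  change f y x = _
  rw [h y x, Finset.sum_comm]
  exact Finset.sum_congr rfl fun j _ => Finset.sum_congr rfl fun i _ => by ring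

theorem isReduced_right (h : IsReducedTwo a f) (x : F) :
    IsReduced (fun j => ∑ i ∈ Finset.range q, a i j * x ^ i) (f x) := by
  intro y
  rw [h x y, Finset.sum_comm]
  exact Finset.sum_congr rfl fun j _ => by rw [Finset.sum_mul]

theorem coeff_eq_zero_right (h : IsReducedTwo a f) {j : ℕ}
    (hj : ∀ x b, IsReduced b (f x) → b j = 0) {i : ℕ} (hi : i < q) : a i j = 0 :=
  coeff_eq_zero_of_forall_sum_eq_zero (b := fun i => a i j)
    (fun x => hj x _ (h.isReduced_right x)) hi

theorem coeff_eq_zero_left (h : IsReducedTwo a f) {i : ℕ}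
    (hi : ∀ y b, IsReduced b (fun x => f x y) → b i = 0) {j : ℕ} (hj : j < q) : a i j = 0 :=
  h.flip.coeff_eq_zero_right hi hj

theorem exists_eq_prime_pow_right (h : IsReducedTwo a f)
    (hadd : ∀ x y z, f x (y + z) = f x y + f x z) {p e : ℕ} (hp : p.Prime) (hF : q = p ^ e)
    {i j : ℕ} (hi : i < q) (hj : j < q) (ha : a i j ≠ 0) : ∃ n < e, p ^ n = j := by
  by_contra hn
  exact ha (h.coeff_eq_zero_right (fun x b hb => by_contra fun hb0 =>
    hn (hb.exists_eq_prime_pow (hadd x) hp hF hj hb0)) hi)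

theorem exists_eq_prime_pow_left (h : IsReducedTwo a f)
    (hadd : ∀ x y z, f (x + y) z = f x z + f y z) {p e : ℕ} (hp : p.Prime) (hF : q = p ^ e)
    {i j : ℕ} (hi : i < q) (hj : j < q) (ha : a i j ≠ 0) : ∃ n < e, p ^ n = i :=
  h.flip.exists_eq_prime_pow_right (fun x y z => hadd y z x) hp hF hj hi ha

end IsReducedTwo

theorem rename_bivariate_mem_restrictDegree (a : ℕ → ℕ → F) :
    MvPolynomial.rename Fin.castSucc (bivariate q a) ∈
      MvPolynomial.restrictDegree (Fin 3) F (q - 1) := by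
  simp only [bivariate, map_sum, map_mul, map_pow, MvPolynomial.rename_C, MvPolynomial.rename_X]
  refine Submodule.sum_mem _ fun i hi => Submodule.sum_mem _ fun j hj => ?_
  rw [Finset.mem_range] at hi hj
  rw [MvPolynomial.mem_restrictDegree]
  intro s hs k
  rw [MvPolynomial.C_mul_X_pow_eq_monomial, MvPolynomial.X_pow_eq_monomial,
    MvPolynomial.monomial_mul] at hs
  rw [Finset.mem_singleton.1 (MvPolynomial.support_monomial_subset hs)]
  fin_cases k <;> simp <;> omega

theorem eq_zero_of_mem_restrictDegree_of_eval_eq_zero {n : ℕ} {f : MvPolynomial (Fin n) F}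
    (hf : f ∈ MvPolynomial.restrictDegree (Fin n) F (q - 1))
    (h : ∀ v, MvPolynomial.eval v f = 0) : f = 0 := by
  have hq : 1 < q := Fintype.one_lt_card
  refine MvPolynomial.eq_zero_of_eval_zero_at_prod_finset f (fun _ => Finset.univ) (fun i => ?_)
    fun v _ => h v
  rw [Finset.card_univ, MvPolynomial.degreeOf_lt_iff (by omega)]
  intro s hs
  have := (MvPolynomial.mem_restrictDegree _ _ _).1 hf s hs i
  omega

/-- Both sides have degree less than `q` in each variable and agree on all of `F³`. -/
theorem eq_rename_bivariate_add_X {T : MvPolynomial (Fin 3) F} (hT : ∀ i, T.degreeOf i < q)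
    {a : ℕ → ℕ → F} (h : ∀ m x y, MvPolynomial.eval ![m, x, y] T =
      MvPolynomial.eval ![m, x] (bivariate q a) + y) :
    T = MvPolynomial.rename Fin.castSucc (bivariate q a) + MvPolynomial.X 2 := by
  have hq : 1 < q := Fintype.one_lt_card
  rw [← sub_eq_zero]
  refine eq_zero_of_mem_restrictDegree_of_eval_eq_zero (Submodule.sub_mem _ ?_
    (Submodule.add_mem _ (rename_bivariate_mem_restrictDegree a) ?_)) fun v => ?_
  rotate_right
  · have hv : v = ![v 0, v 1, v 2] := by ext i; fin_cases i <;> rfl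
    have hv' : v ∘ Fin.castSucc = ![v 0, v 1] := by ext i; fin_cases i <;> rfl
    rw [map_sub, map_add, MvPolynomial.eval_rename, hv', MvPolynomial.eval_X, ← h, ← hv, sub_self]
  · rw [MvPolynomial.mem_restrictDegree]
    intro s hs i
    have := (MvPolynomial.monomial_le_degreeOf i hs).trans_lt (hT i)
    omega
  · rw [MvPolynomial.mem_restrictDegree]
    intro s hs i
    rw [MvPolynomial.support_X, Finset.mem_singleton] at hs
    rw [hs, Finsupp.single_apply]
    split_ifs <;> omega

end ReducedPolynomials
-- From transitivities to laws of the multiplication.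
theorem IsAtLeastLenzBarlottiII2.exists_transitive {P L : Type*} [Membership P L]
    (h : IsAtLeastLenzBarlottiII2 P L) : ∃ (A : P) (l : L), A ∉ l ∧ IsTransitive A l := by
  obtain ⟨S, hS, A, B, l, m, -, -, -, hB, rfl⟩ := h
  exact ⟨B, m, hB, hS (Or.inr rfl)⟩

theorem sum_eq_zero_of_injective {F : Type*} [Field F] [Fintype F] (hq : 2 < Fintype.card F)
    {φ : F → F} (h : Function.Injective φ) : ∑ x, φ x = 0 := by
  rw [(Finite.injective_iff_bijective.1 h).sum_comp fun x => x]
  simpa using FiniteField.sum_pow_lt_card_sub_one F 1 (by omega)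

namespace Coordinatisation.IsTernary

variable {P L F : Type*} [Membership P L] [ProjectivePlane P L] [Field F]
  {c : Coordinatisation P L F} {t : F → F → F → F}

/-- At slope 1 the shift `τ` with `τ 0 = y` must be `x ↦ x + y`; applying it at slope `m` separates
the last variable. -/
theorem eq_add (ht : c.IsTernary t) (h : IsTransitive c.Y c.lineInf)
    (hadd : ∀ x y, t 1 x y = x + y) (m x y : F) : t m x y = t m x 0 + y := by
  obtain ⟨τ, h0, hτ⟩ := ht.exists_shift_of_transitive h y
  have h1 : ∀ x, τ x = x + y := fun x => by
    have := hτ 1 x 0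
    rw [h0, hadd, hadd, add_zero] at this
    exact this.symm
  have := hτ m x 0
  rwa [h0, h1] at this

/-- The homology taking `(1, 0)` to `(y, 0)` multiplies abscissas by `y` on the left, while its
slope map `μ` inverts right multiplication by `y`. Invariance of `t` under the pair is
associativity. -/
theorem mul_assoc_of_transitive (ht : c.IsTernary t) (hone : ∀ x, t 1 x 0 = x)
    (h : IsTransitive (c.slope 0) (c.vline 0)) (x y z : F) :
    t x (t y z 0) 0 = t (t x y 0) z 0 := by
  by_cases hy : y = 0
  · rw [hy, ht.zero_left, ht.zero_mid, ht.zero_left]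
  obtain ⟨σ, μ, h1, hμ, key⟩ := ht.exists_of_transitive_zero h hy
  have hμ1 : ∀ m, m = t (μ m) y 0 := fun m => by
    rw [← h1, key, ht.one_zero]
  -- The slope `n` sent to 1 turns out to be `y`; comparing at this slope computes `σ`.
  obtain ⟨n, hn⟩ := hμ 1
  have hσ : ∀ z, σ z = t y z 0 := fun z => by
    have h2 := hμ1 n
    rw [hn, hone] at h2
    rw [← h2, ← key, hn, hone]
  obtain ⟨m, rfl⟩ := hμ x
  rw [← hσ, key, ← hμ1]

/-- Abscissa 0 shows that `κ m` is translation by `t m y 0`; slope 1 then shows `σ x = x + y`. -/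
theorem add_right_of_transitive (ht : c.IsTernary t) (hlin : ∀ m x y, t m x y = t m x 0 + y)
    (hone : ∀ x, t 1 x 0 = x) (h : IsTransitive (c.slope 0) c.lineInf) (m x y : F) :
    t m (x + y) 0 = t m x 0 + t m y 0 := by
  obtain ⟨σ, κ, h0, key⟩ := ht.exists_of_transitive_slope_zero h y
  have hκ : ∀ m k, κ m k = t m y 0 + k := fun m k => by
    have := key m 0 k
    rw [h0, ht.zero_mid, hlin] at this
    exact this.symm
  have hσ : σ x = x + y := by
    have := key 1 x 0
    rw [hκ, hone, hone, hone] at this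
    rw [this, add_comm]
  rw [← hσ, key, hκ, add_comm]

/-- Slope 0 determines `ρ x 0 = -t n x 0`; abscissa 1 then shows `μ m = m + n`. -/
theorem add_left_of_transitive (ht : c.IsTernary t) (hlin : ∀ m x y, t m x y = t m x 0 + y)
    (h : IsTransitive c.Y (c.vline 0)) (m n x : F) :
    t (m + n) x 0 = t m x 0 + t n x 0 := by
  obtain ⟨μ, ρ, h0, key⟩ := ht.exists_of_transitive_vline_zero h n
  have hρ : ∀ x, t n x 0 + ρ x 0 = 0 := fun x => by
    have := key 0 x 0
    rwa [h0, hlin, ht.zero_left] at this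
  have h2 : ∀ m x, t (μ m) x 0 = t m x 0 + t n x 0 := fun m x => by
    have := key m x 0
    rw [hlin] at this
    linear_combination this - hρ x
  have hμ : μ m = m + n := by
    have := h2 m 1
    rwa [ht.one_zero, ht.one_zero, ht.one_zero] at this
  rw [← hμ, h2]

end Coordinatisation.IsTernary
end PlaneCoord

/-! ### The shape of the PTR polynomial. -/

theorem mainTheorem3 {P L F : Type*} [Membership P L] [ProjectivePlane P L] [Finite P] [Finite L]
    [Field F] [Fintype F] (p e : ℕ) (hp : p.Prime) (hF : Fintype.card F = p ^ e)
    (horder : ProjectivePlane.order P L = p ^ e)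
    (c : PlaneCoord.Coordinatisation P L F)
    (hopt : c.IsOptimal)
    (htrans : PlaneCoord.IsTransitive c.Y c.lineInf)
    (helem : PlaneCoord.IsElementaryAbelian p (PlaneCoord.centralCollineations c.Y c.lineInf))
    (T : MvPolynomial (Fin 3) F)
    (hT : PlaneCoord.IsPTRPolynomial c T)
    (hadd : ∀ x y : F, MvPolynomial.eval ![1, x, y] T = x + y) :
    ∃ M : MvPolynomial (Fin 2) F,
      T = MvPolynomial.rename Fin.castSucc M + MvPolynomial.X 2 ∧
      (∃ a : ℕ → ℕ → F, M = ∑ i ∈ Finset.Icc 1 (p ^ e - 1), ∑ j ∈ Finset.Icc 1 (p ^ e - 1),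
        MvPolynomial.C (a i j) * MvPolynomial.X 0 ^ i * MvPolynomial.X 1 ^ j) ∧
      (2 < p ^ e →
        ∃ a : ℕ → ℕ → F, M = ∑ i ∈ Finset.Icc 1 (p ^ e - 2), ∑ j ∈ Finset.Icc 1 (p ^ e - 2),
          MvPolynomial.C (a i j) * MvPolynomial.X 0 ^ i * MvPolynomial.X 1 ^ j) ∧
      (PlaneCoord.IsAtLeastLenzBarlottiII2 P L →
        ∀ x y z : F, MvPolynomial.eval ![x, MvPolynomial.eval ![y, z] M] M =
          MvPolynomial.eval ![MvPolynomial.eval ![x, y] M, z] M) ∧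
      (PlaneCoord.IsTranslationPlane P L →
        ∃ a : ℕ → ℕ → F, M = ∑ i ∈ Finset.Icc 1 (p ^ e - 1), ∑ j ∈ Finset.range e,
          MvPolynomial.C (a i j) * MvPolynomial.X 0 ^ i * MvPolynomial.X 1 ^ (p ^ j)) ∧
      (PlaneCoord.IsDualTranslationPlane P L →
        ∃ a : ℕ → ℕ → F, M = ∑ i ∈ Finset.range e, ∑ j ∈ Finset.Icc 1 (p ^ e - 1),
          MvPolynomial.C (a i j) * MvPolynomial.X 0 ^ (p ^ i) * MvPolynomial.X 1 ^ j) ∧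
      (PlaneCoord.IsAtLeastLenzBarlottiV P L →
        ∃ a : ℕ → ℕ → F, M = ∑ i ∈ Finset.range e, ∑ j ∈ Finset.range e,
          MvPolynomial.C (a i j) * MvPolynomial.X 0 ^ (p ^ i) * MvPolynomial.X 1 ^ (p ^ j)) := by
  classical
  set t : F → F → F → F := fun m x y => MvPolynomial.eval ![m, x, y] T with ht_def
  have ht : c.IsTernary t := hT.2
  have hlin := ht.eq_add htrans hadd
  have hone : ∀ x, t 1 x 0 = x := fun x => (hadd x 0).trans (add_zero x)
  obtain ⟨a, ha⟩ := PlaneCoord.exists_isReducedTwo fun m x => t m x 0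
  have hev : ∀ x y, MvPolynomial.eval ![x, y] (PlaneCoord.bivariate (Fintype.card F) a) =
      t x y 0 := fun x y => (PlaneCoord.eval_bivariate _ a x y).trans (ha x y).symm
  have hl0 : ∀ i < Fintype.card F, ∀ j < Fintype.card F, a i j ≠ 0 → i ≠ 0 := by
    rintro i - j hj h rfl
    exact h (ha.coeff_eq_zero_left (fun y b hb => hb.coeff_zero (ht.zero_left y 0)) hj)
  have hr0 : ∀ i < Fintype.card F, ∀ j < Fintype.card F, a i j ≠ 0 → j ≠ 0 := by
    rintro i hi j - h rfl
    exact h (ha.coeff_eq_zero_right (fun y b hb => hb.coeff_zero (ht.zero_mid y 0)) hi)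
  have hid : Function.Injective fun i : ℕ => i := fun _ _ h => h
  have hpow : Function.Injective fun i : ℕ => p ^ i := Nat.pow_right_injective hp.two_le
  have hq : 1 < Fintype.card F := Fintype.one_lt_card
  have hIcc : ∀ i ∈ Finset.Icc 1 (p ^ e - 1), i < Fintype.card F := fun i hi => by
    rw [Finset.mem_Icc] at hi; omega
  have hrange : ∀ i ∈ Finset.range e, p ^ i < Fintype.card F := fun i hi => by
    rw [hF]; exact Nat.pow_lt_pow_right hp.one_lt (Finset.mem_range.1 hi)
  have hIcc' : ∀ {i}, i < Fintype.card F → i ≠ 0 → ∃ k ∈ Finset.Icc 1 (p ^ e - 1), k = i :=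
    fun {i} hi h => ⟨i, Finset.mem_Icc.2 (by omega), rfl⟩
  have hright : PlaneCoord.IsTranslationPlane P L → ∀ i < Fintype.card F, ∀ j < Fintype.card F,
      a i j ≠ 0 → ∃ k ∈ Finset.range e, p ^ k = j := fun h i hi j hj h0 => by
    -- Of the translation line `[∞]` only the center `(0)` is needed.
    have h1 := hopt.2.2.1 h (c.slope 0) (c.slope_mem 0).2
    obtain ⟨n, hn, hn'⟩ := ha.exists_eq_prime_pow_right
      (ht.add_right_of_transitive hlin hone h1) hp hF hi hj h0
    exact ⟨n, Finset.mem_range.2 hn, hn'⟩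
  have hleft : PlaneCoord.IsDualTranslationPlane P L → ∀ i < Fintype.card F,
      ∀ j < Fintype.card F, a i j ≠ 0 → ∃ k ∈ Finset.range e, p ^ k = i := fun h i hi j hj h0 => by
    -- Of the translation point `(∞)` only the axis `[0]` is needed.
    have h1 := hopt.2.2.2 h (c.vline 0) (c.Y_mem_vline 0)
    obtain ⟨n, hn, hn'⟩ := ha.exists_eq_prime_pow_left
      (ht.add_left_of_transitive hlin h1) hp hF hi hj h0
    exact ⟨n, Finset.mem_range.2 hn, hn'⟩
  refine ⟨PlaneCoord.bivariate (Fintype.card F) a,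
    PlaneCoord.eq_rename_bivariate_add_X hT.1 fun m x y => by rw [hev]; exact hlin m x y,
    ⟨_, PlaneCoord.bivariate_eq_sum hid hid hIcc hIcc fun i hi j hj h =>
      ⟨hIcc' hi (hl0 i hi j hj h), hIcc' hj (hr0 i hi j hj h)⟩⟩,
    fun h2 => ⟨_, PlaneCoord.bivariate_eq_sum hid hid ?_ ?_ fun i hi j hj h => ?_⟩, ?_,
    fun h => ⟨fun i j => a i (p ^ j), PlaneCoord.bivariate_eq_sum hid hpow hIcc hrange
      fun i hi j hj h0 => ⟨hIcc' hi (hl0 i hi j hj h0), hright h i hi j hj h0⟩⟩,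
    fun h => ⟨fun i j => a (p ^ i) j, PlaneCoord.bivariate_eq_sum hpow hid hrange hIcc
      fun i hi j hj h0 => ⟨hleft h i hi j hj h0, hIcc' hj (hr0 i hi j hj h0)⟩⟩,
    fun ⟨V, l, _, hl, hV⟩ => ⟨fun i j => a (p ^ i) (p ^ j),
      PlaneCoord.bivariate_eq_sum hpow hpow hrange hrange
      fun i hi j hj h0 => ⟨hleft ⟨V, hV⟩ i hi j hj h0, hright ⟨l, hl⟩ i hi j hj h0⟩⟩⟩
  · intro i hi; rw [Finset.mem_Icc] at hi; omega
  · intro i hi; rw [Finset.mem_Icc] at hi; omega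
  · rw [← hF] at h2
    have hi0 := hl0 i hi j hj h
    have hj0 := hr0 i hi j hj h
    have hi1 : i ≠ Fintype.card F - 1 := by
      rintro rfl
      refine h (ha.coeff_eq_zero_left (fun y b hb => hb.coeff_card_sub_one ?_) hj)
      -- For `y = 0` the function is identically 0, otherwise it is a permutation; its values sum to
      -- 0 either way.
      by_cases hy : y = 0
      · exact Finset.sum_eq_zero fun x _ => by rw [hy]; exact ht.zero_mid x 0
      · exact PlaneCoord.sum_eq_zero_of_injective h2 (ht.injective_left hy)
    have hj1 : j ≠ Fintype.card F - 1 := by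
      rintro rfl
      refine h (ha.coeff_eq_zero_right (fun x b hb => hb.coeff_card_sub_one ?_) hi)
      by_cases hx : x = 0
      · exact Finset.sum_eq_zero fun y _ => by rw [hx]; exact ht.zero_left y 0
      · exact PlaneCoord.sum_eq_zero_of_injective h2 (ht.injective_mid hx)
    exact ⟨⟨i, Finset.mem_Icc.2 (by omega), rfl⟩, ⟨j, Finset.mem_Icc.2 (by omega), rfl⟩⟩
  · intro h x y z
    rw [hev, hev, hev, hev]
    exact ht.mul_assoc_of_transitive hone (hopt.2.1 h.exists_transitive) x y z
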